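/- A digraph may have loops; $N^+(v)$ and $N^-(v)$ denote the sets of out-neighbours and of in-neighbours of a vertex $v$ (both contain $v$ if there is a loop at $v$), the out-degree and in-degree of $v$ are $|N^+(v)|$ and $|N^-(v)|$, and the strict out- and in-neighbourhoods are $N^+(v)\setminus\{v\}$ and $N^-(v)\setminus\{v\}$. An oriented graph is a digraph in which any two distinct vertices are joined by at most one arc. A reflexive tournament is a digraph with a loop at every vertex in which any two distinct vertices are joined by exactly one arc. An ios-injective homomorphism from $G$ to $H$ is a homomorphism $f:G\to H$ such that, for every vertex $u$ of $G$, $f$ is injective on $N^+(u)$ and injective on $N^-(u)$. For a fixed digraph $H$, the problem of ios-injective homomorphism to $H$ is: given a finite oriented graph $G$ (by its adjacency matrix), decide whether there is an ios-injective homomorphism from $G$ to $H$. A decision problem $P$ polynomially transforms to a decision problem $Q$ if there is a polynomial-time computable map $f$ from instances of $P$ to instances of $Q$ such that $I$ is a yes-instance of $P$ if and only if $f(I)$ is a yes-instance of $Q$. Let $T$ be a finite reflexive tournament and let $v$ be a vertex of $T$. (i) If $v$ has out-degree at least four, then ios-injective homomorphism to $T'$ polynomially transforms to ios-injective homomorphism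 to $T$, where $T'$ is the reflexive tournament induced by the strict out-neighbourhood of $v$. (ii) If $v$ has in-degree at least four, then ios-injective homomorphism to $T'$ polynomially transforms to ios-injective homomorphism to $T$, where $T'$ is the reflexive tournament induced by the strict in-neighbourhood of $v$. -/

import Mathlib

/-! ### Digraphs, reflexive tournaments and ios-injective homomorphisms -/

namespace Digraph

/-- The out-neighbourhood `N⁺(v)`; it contains `v` itself if there is a loop at `v`. -/
def outNbhd {V : Type*} (G : Digraph V) (v : V) : Set V := {u | G.Adj v u}

/-- The in-neighbourhood `N⁻(v)`; it contains `v` itself if there is a loop at `v`. -/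
def inNbhd {V : Type*} (G : Digraph V) (v : V) : Set V := {u | G.Adj u v}

/-- The strict out-neighbourhood `N⁺(v) \ {v}`. -/
def strictOutNbhd {V : Type*} (G : Digraph V) (v : V) : Set V := G.outNbhd v \ {v}

/-- The strict in-neighbourhood `N⁻(v) \ {v}`. -/
def strictInNbhd {V : Type*} (G : Digraph V) (v : V) : Set V := G.inNbhd v \ {v}

/-- The subdigraph induced by a set of vertices. -/
def inducedOn {V : Type*} (G : Digraph V) (S : Set V) : Digraph S where
  Adj u w := G.Adj u w

/-- Oriented graphs: any two distinct vertices are joined by at most one arc (loops are allowed). -/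
def IsOriented {V : Type*} (G : Digraph V) : Prop :=
  ∀ u w, u ≠ w → G.Adj u w → ¬ G.Adj w u

/-- Reflexive tournaments: there is a loop at every vertex, and any two distinct vertices are
joined by exactly one arc. -/
def IsReflexiveTournament {V : Type*} (T : Digraph V) : Prop :=
  (∀ u, T.Adj u u) ∧ ∀ u w, u ≠ w → Xor (T.Adj u w) (T.Adj w u)

/-- `f` is an ios-injective homomorphism from `G` to `H`: a homomorphism that is injective on each
in-neighbourhood and on each out-neighbourhood of `G`, separately. -/
def IsIosInjectiveHom {V W : Type*} (G : Digraph V) (H : Digraph W) (f : V → W) : Prop :=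
  (∀ u w, G.Adj u w → H.Adj (f u) (f w)) ∧
    ∀ u, Set.InjOn f (G.outNbhd u) ∧ Set.InjOn f (G.inNbhd u)

end Digraph

/-! ### Decision problems and polynomial transformations -/

/-- A decision problem: a type of instances, written as words over a finite alphabet, and the set
of its yes-instances. -/
structure DecisionProblem where
  Instance : Type
  Alphabet : Type
  alphabetFinite : Finite Alphabet
  encode : Instance → List Alphabet
  encode_injective : Function.Injective encode
  Yes : Instance → Prop

/-- `P` polynomially transforms to `Q`: some map from instances of `P` to instances of `Q`, computed
by a Turing machine in time polynomial in the length of the input word, satisfies that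
`I` is a yes-instance of `P` if and only if its image is a yes-instance of `Q`. -/
def DecisionProblem.PolynomiallyTransformsTo (P Q : DecisionProblem) : Prop :=
  ∃ f : P.Instance → Q.Instance,
    Nonempty (Turing.TM2ComputableInPolyTime P.encode Q.encode f) ∧ ∀ I, P.Yes I ↔ Q.Yes (f I)

/-! ### The problem of ios-injective homomorphism to a fixed target -/

/-- A finite oriented graph on the vertex set `{0, …, order - 1}`, given by its adjacency matrix. -/
structure OrientedGraphInstance where
  order : ℕ
  matrix : Fin order → Fin order → Bool
  oriented : (Digraph.mk' matrix).IsOriented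

namespace OrientedGraphInstance

/-- The oriented graph with the given adjacency matrix. -/
def graph (I : OrientedGraphInstance) : Digraph (Fin I.order) := Digraph.mk' I.matrix

/-- The row of index `u` of the adjacency matrix, followed by the end-of-row symbol `none`. -/
def encodeRow (I : OrientedGraphInstance) (u : Fin I.order) : List (Option Bool) :=
  List.ofFn (fun w => some (I.matrix u w)) ++ [none]

/-- The adjacency matrix written row by row. -/
def encode (I : OrientedGraphInstance) : List (Option Bool) :=
  (List.ofFn I.encodeRow).flatten

theorem encode_injective : Function.Injective encode := by
  have hcount : ∀ I : OrientedGraphInstance, I.encode.count none = I.order := by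
    intro I
    have h : (List.count none ∘ I.encodeRow) = fun _ => 1 := by
      funext u
      simp only [Function.comp_apply, encodeRow, List.count_append, List.count_singleton_self,
        Nat.add_eq_right, List.count_eq_zero, List.mem_ofFn]
      rintro ⟨w, hw⟩
      cases hw
    simp [encode, List.count_flatten, List.map_ofFn, h]
  rintro ⟨n, A, hA⟩ ⟨m, B, hB⟩ h
  obtain rfl : n = m := by
    have h1 := hcount ⟨n, A, hA⟩
    rw [h, hcount] at h1
    exact h1.symm
  have hlen : ∀ I : OrientedGraphInstance,
      (List.ofFn I.encodeRow).map List.length = List.ofFn fun _ : Fin I.order => I.order + 1 := by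
    intro I
    rw [List.map_ofFn]
    congr 1
    funext u
    simp [encodeRow]
  have h2 := List.eq_iff_flatten_eq.2 ⟨h, (hlen ⟨n, A, hA⟩).trans (hlen ⟨n, B, hB⟩).symm⟩
  have h3 := List.ofFn_injective h2
  have h4 : A = B := by
    funext u w
    have h5 := congrFun h3 u
    simp only [encodeRow, List.append_cancel_right_eq] at h5
    exact Option.some_injective _ (congrFun (List.ofFn_injective h5) w)
  subst h4
  rfl

end OrientedGraphInstance

/-- Ios-injective homomorphism to `T` (ios-injective `T`-colouring): given a finite oriented graph
`G`, is there an ios-injective homomorphism from `G` to `T`? -/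
def iosInjectiveHomProblem {V : Type*} (T : Digraph V) : DecisionProblem where
  Instance := OrientedGraphInstance
  Alphabet := Option Bool
  alphabetFinite := inferInstance
  encode := OrientedGraphInstance.encode
  encode_injective := OrientedGraphInstance.encode_injective
  Yes G := ∃ f : Fin G.order → V, G.graph.IsIosInjectiveHom T f

/-! ### Reversal, relabelling, and injective endomorphisms of tournaments. -/

namespace Digraph

/-! Hang on each vertex `i` of `G` a copy of `T` whose image under any ios-injective homomorphism is
all of `T`. Such a homomorphism restricts to an automorphism of `T` on each copy: the ends of an arc
get different colours because one of them carries a loop, so that both lie in one neighbourhood. Now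
`q i` has an arc to the copy of `v`. Its colour is that of some `u` in the copy with an arc to `v`,
and in-injectivity at the copy of `v` leaves only `u = v`. Dually, `q (i - 1)` has the colour of the
`i`-th copy of `v`. Hence all `q i` share one colour `c`.

Each `i` is an out-neighbour of `q i`, so its colour is an out-neighbour of `c`; it is not `c`,
since the copy of `v` is another out-neighbour of `q i` and has colour `c`. Undoing the automorphism
of one copy moves `c` to `v` and colours `G` by the strict out-neighbourhood of `v`. Conversely,
such a colouring extends by `v` on every `q i` and the identity on every copy; dropping the loop at
`v` in the copies makes this injective on neighbourhoods (`exists_attachCopies_iff`). The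
in-neighbourhood case follows by reversing all arcs.

For computability, the new adjacency matrix arises by replacing each entry with a block of fixed
size that depends only on the entry and on whether it lies on the diagonal, next to it, or
elsewhere. An explicit stack machine does this in time linear in the length of the input
(`nonempty_computable_expand`). -/

/-- The digraph with all arcs reversed. -/
def reverse {V : Type*} (G : Digraph V) : Digraph V where
  Adj u w := G.Adj w u

theorem IsOriented.reverse {V : Type*} {G : Digraph V} (hG : G.IsOriented) :
    G.reverse.IsOriented :=
  fun u w huw h => hG w u huw.symm h

theorem IsReflexiveTournament.reverse {V : Type*} {T : Digraph V}
    (hT : T.IsReflexiveTournament) : T.reverse.IsReflexiveTournament :=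
  ⟨hT.1, fun u w huw => hT.2 w u huw.symm⟩

theorem IsIosInjectiveHom.eq_of_adj {V W : Type*} {G : Digraph V} {H : Digraph W} {f : V → W}
    (hf : G.IsIosInjectiveHom H f) (u a b : V) (ha : G.Adj u a) (hb : G.Adj u b)
    (h : f a = f b) : a = b :=
  (hf.2 u).1 ha hb h

theorem IsIosInjectiveHom.eq_of_adj' {V W : Type*} {G : Digraph V} {H : Digraph W} {f : V → W}
    (hf : G.IsIosInjectiveHom H f) (u a b : V) (ha : G.Adj a u) (hb : G.Adj b u)
    (h : f a = f b) : a = b :=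
  (hf.2 u).2 ha hb h

theorem isIosInjectiveHom_reverse_iff {V W : Type*} {G : Digraph V} {H : Digraph W} {f : V → W} :
    G.reverse.IsIosInjectiveHom H.reverse f ↔ G.IsIosInjectiveHom H f :=
  ⟨fun h => ⟨fun u w => h.1 w u, fun u => (h.2 u).symm⟩,
    fun h => ⟨fun u w => h.1 w u, fun u => (h.2 u).symm⟩⟩

theorem exists_isIosInjectiveHom_congr {V V' W : Type*} {G : Digraph V} {G' : Digraph V'}
    (H : Digraph W) (e : V ≃ V') (he : ∀ u w, G.Adj u w ↔ G'.Adj (e u) (e w)) :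
    (∃ f, G.IsIosInjectiveHom H f) ↔ ∃ f, G'.IsIosInjectiveHom H f := by
  constructor
  · rintro ⟨f, hf, hi⟩
    have he' : ∀ u w, G'.Adj u w → G.Adj (e.symm u) (e.symm w) := by
      intro u w h
      simpa [he] using h
    refine ⟨f ∘ e.symm, fun u w h => hf _ _ (he' u w h), fun u => ⟨?_, ?_⟩⟩
    · intro a ha b hb hab
      exact e.symm.injective ((hi (e.symm u)).1 (he' _ _ ha) (he' _ _ hb) hab)
    · intro a ha b hb hab
      exact e.symm.injective ((hi (e.symm u)).2 (he' _ _ ha) (he' _ _ hb) hab)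
  · rintro ⟨f, hf, hi⟩
    refine ⟨f ∘ e, fun u w h => hf _ _ ((he u w).1 h), fun u => ⟨?_, ?_⟩⟩
    · intro a ha b hb hab
      exact e.injective ((hi (e u)).1 ((he _ _).1 ha) ((he _ _).1 hb) hab)
    · intro a ha b hb hab
      exact e.injective ((hi (e u)).2 ((he _ _).1 ha) ((he _ _).1 hb) hab)

/-- An injective endomorphism of a reflexive tournament reflects arcs. -/
theorem IsReflexiveTournament.adj_of_adj_map {V : Type*} {T : Digraph V}
    (hT : T.IsReflexiveTournament) {σ : V → V} (hσ : Function.Injective σ)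
    (hom : ∀ u w, T.Adj u w → T.Adj (σ u) (σ w)) {u w : V} (h : T.Adj (σ u) (σ w)) :
    T.Adj u w := by
  by_contra hn
  have huw : u ≠ w := by
    rintro rfl
    exact hn (hT.1 u)
  have hwu : T.Adj w u := by
    rcases hT.2 u w huw with h1 | h1
    · exact absurd h1.1 hn
    · exact h1.1
  rcases hT.2 _ _ (hσ.ne huw) with h1 | h1
  · exact h1.2 (hom _ _ hwu)
  · exact h1.2 h

theorem IsReflexiveTournament.isOriented {V : Type*} {T : Digraph V}
    (hT : T.IsReflexiveTournament) : T.IsOriented := by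
  intro u w huw h1 h2
  rcases hT.2 u w huw with h | h
  · exact h.2 h2
  · exact h.2 h1

/-! ### The gadget and the homomorphisms from it. -/

/-- The digraph obtained from `G` by attaching to each vertex `i` a new vertex `q i`, with an arc
to `i`, and a copy of `T` without its loop at `v`; `q i` also has an arc to the `i`-th copy of `v`,
and that copy has an arc to `q (i - 1)`. The vertex `i` is written `(i, none)`, the vertex `q i`
is `(i, some none)`, and `(i, some (some u))` is the vertex `u` of the `i`-th copy of `T`. -/
def attachCopies {n : ℕ} {V : Type*} (G : Digraph (Fin n)) (T : Digraph V) (v : V) :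
    Digraph (Fin n × Option (Option V)) where
  Adj
    | (i, none), (j, none) => G.Adj i j
    | (_, none), (_, some _) => False
    | (i, some none), (j, none) => i = j
    | (_, some none), (_, some none) => False
    | (i, some none), (j, some (some w)) => i = j ∧ w = v
    | (_, some (some _)), (_, none) => False
    | (i, some (some u)), (j, some none) => u = v ∧ (j : ℕ) + 1 = i
    | (i, some (some u)), (j, some (some w)) => i = j ∧ T.Adj u w ∧ ¬ (u = v ∧ w = v)

section attachCopies

variable {n : ℕ} {V : Type*} {G : Digraph (Fin n)} {T : Digraph V} {v : V}

theorem attachCopies_isOriented (hG : G.IsOriented) (hT : T.IsReflexiveTournament) :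
    (G.attachCopies T v).IsOriented := by
  rintro ⟨i, _ | _ | u⟩ ⟨j, _ | _ | w⟩ hne h1 h2 <;> simp only [attachCopies] at h1 h2
  · exact hG i j (fun h => hne (by rw [h])) h1 h2
  · obtain ⟨rfl, -⟩ := h1
    omega
  · obtain ⟨rfl, -⟩ := h2
    omega
  · obtain ⟨rfl, h1, -⟩ := h1
    exact hT.isOriented u w (fun h => hne (by rw [h])) h1 h2.2.1

/-- An ios-injective homomorphism maps each attached copy of `T` onto `T`. -/
theorem IsIosInjectiveHom.attachCopies_copy [Finite V] (hT : T.IsReflexiveTournament)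
    {g : Fin n × Option (Option V) → V} (hg : (G.attachCopies T v).IsIosInjectiveHom T g)
    (i : Fin n) :
    Function.Bijective (fun u => g (i, some (some u))) ∧
      ∀ u w, T.Adj u w → T.Adj (g (i, some (some u))) (g (i, some (some w))) := by
  -- At most one of `u`, `w` is `v`, so one of them keeps its loop. Both are then in-neighbours of
  -- `w`, or both are out-neighbours of `u`.
  have key : ∀ u w, u ≠ w → T.Adj u w → g (i, some (some u)) ≠ g (i, some (some w)) := by
    intro u w huw h heq
    by_cases hu : u = v
    · have hw : w ≠ v := fun h' => huw (hu.trans h'.symm)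
      have := hg.eq_of_adj' (i, some (some w)) (i, some (some u)) (i, some (some w))
        ⟨rfl, h, fun h' => hw h'.2⟩ ⟨rfl, hT.1 w, fun h' => hw h'.2⟩ heq
      simp [huw] at this
    · have := hg.eq_of_adj (i, some (some u)) (i, some (some u)) (i, some (some w))
        ⟨rfl, hT.1 u, fun h' => hu h'.1⟩ ⟨rfl, h, fun h' => hu h'.1⟩ heq
      simp [huw] at this
  refine ⟨Finite.injective_iff_bijective.1 ?_, ?_⟩
  · intro u w heq
    by_contra huw
    rcases hT.2 u w huw with h | h
    · exact key u w huw h.1 heq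
    · exact key w u (Ne.symm huw) h.1 heq.symm
  · intro u w h
    by_cases huw : u = v ∧ w = v
    · obtain ⟨rfl, rfl⟩ := huw
      exact hT.1 _
    · exact hg.1 (i, some (some u)) (i, some (some w)) ⟨rfl, h, huw⟩

/-- The copy exhausts all colours, so `q i` shares its colour with some `u` in it, and `u` has an
arc to `v`. If `u ≠ v`, then `u` and `q i` are two in-neighbours of the copy of `v` with the same
colour. -/
theorem IsIosInjectiveHom.attachCopies_link [Finite V] (hT : T.IsReflexiveTournament)
    {g : Fin n × Option (Option V) → V} (hg : (G.attachCopies T v).IsIosInjectiveHom T g)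
    (i : Fin n) : g (i, some none) = g (i, some (some v)) := by
  obtain ⟨hb, hom⟩ := hg.attachCopies_copy hT i
  obtain ⟨u, hu⟩ := hb.2 (g (i, some none))
  have hadj : T.Adj (g (i, some none)) (g (i, some (some v))) := hg.1 (i, _) (i, _) ⟨rfl, rfl⟩
  rw [← hu] at hadj ⊢
  have huv := hT.adj_of_adj_map hb.1 hom hadj
  by_cases h : u = v
  · rw [h]
  · have := hg.eq_of_adj' (i, some (some v)) (i, some (some u)) (i, some none)
      ⟨rfl, huv, fun h' => h h'.1⟩ ⟨rfl, rfl⟩ hu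
    simp at this

/-- The dual argument, with out-neighbours of the copy of `v`. Together with `attachCopies_link` it
carries the colour from one `q j` to the next. -/
theorem IsIosInjectiveHom.attachCopies_prev [Finite V] (hT : T.IsReflexiveTournament)
    {g : Fin n × Option (Option V) → V} (hg : (G.attachCopies T v).IsIosInjectiveHom T g)
    {i j : Fin n} (hij : (j : ℕ) + 1 = i) : g (j, some none) = g (i, some (some v)) := by
  obtain ⟨hb, hom⟩ := hg.attachCopies_copy hT i
  obtain ⟨u, hu⟩ := hb.2 (g (j, some none))
  have hadj : T.Adj (g (i, some (some v))) (g (j, some none)) := hg.1 (i, _) (j, _) ⟨rfl, hij⟩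
  rw [← hu] at hadj ⊢
  have huv := hT.adj_of_adj_map hb.1 hom hadj
  by_cases h : u = v
  · rw [h]
  · have := hg.eq_of_adj (i, some (some v)) (i, some (some u)) (j, some none)
      ⟨rfl, huv, fun h' => h h'.2⟩ ⟨rfl, hij⟩ hu
    simp at this

theorem IsIosInjectiveHom.attachCopies_link_eq [Finite V] (hT : T.IsReflexiveTournament)
    {g : Fin n × Option (Option V) → V} (hg : (G.attachCopies T v).IsIosInjectiveHom T g)
    (h0 : 0 < n) (i : ℕ) (hi : i < n) :
    g (⟨i, hi⟩, some none) = g (⟨0, h0⟩, some none) := by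
  induction i with
  | zero => rfl
  | succ k ih =>
    rw [hg.attachCopies_link hT, ← ih (by omega)]
    exact (hg.attachCopies_prev hT rfl).symm

theorem exists_attachCopies_iff [Finite V] (hT : T.IsReflexiveTournament) :
    (∃ f : Fin n → T.strictOutNbhd v,
        G.IsIosInjectiveHom (T.inducedOn (T.strictOutNbhd v)) f) ↔
      ∃ g : Fin n × Option (Option V) → V, (G.attachCopies T v).IsIosInjectiveHom T g := by
  constructor
  · rintro ⟨f, hf, hi⟩
    have hne : ∀ i, (f i : V) ≠ v := fun i => (f i).2.2
    have hinj := fun i => (hi i).1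
    have hinj' := fun i => (hi i).2
    refine ⟨fun p => match p with
      | (i, none) => f i
      | (_, some none) => v
      | (_, some (some u)) => u, ?_, ?_⟩
    · rintro ⟨i, _ | _ | u⟩ ⟨j, _ | _ | w⟩ h <;> simp only [attachCopies] at h
      · exact hf i j h
      · subst h
        exact (f i).2.1
      · obtain ⟨rfl, rfl⟩ := h
        exact hT.1 _
      · obtain ⟨rfl, -⟩ := h
        exact hT.1 _
      · exact h.2.1
    · refine fun p => ⟨?_, ?_⟩
      · rintro ⟨i, _ | _ | u⟩ h1 ⟨j, _ | _ | w⟩ h2 h <;> rcases p with ⟨k, _ | _ | t⟩ <;>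
          simp only [attachCopies, outNbhd, Set.mem_ofPred_eq] at h1 h2 h
        · rw [hinj k h1 h2 (Subtype.ext h)]
        · rw [← h1, ← h2]
        · exact absurd (h.trans h2.2) (hne i)
        · rw [Fin.ext (by omega : (i : ℕ) = j)]
        -- Both `q (k - 1)` and the copy of `v` have colour `v`. Only the missing loop keeps them
        -- from being common out-neighbours of that copy.
        · subst h
          exact absurd ⟨h1.1, rfl⟩ h2.2.2
        · exact absurd (h.symm.trans h1.2) (hne j)
        · subst h
          exact absurd ⟨h2.1, rfl⟩ h1.2.2
        · rw [← h1.1, ← h2.1, h]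
        · rw [← h1.1, ← h2.1, h]
      · rintro ⟨i, _ | _ | u⟩ h1 ⟨j, _ | _ | w⟩ h2 h <;> rcases p with ⟨k, _ | _ | t⟩ <;>
          simp only [attachCopies, inNbhd, Set.mem_ofPred_eq] at h1 h2 h
        · rw [hinj' k h1 h2 (Subtype.ext h)]
        · exact absurd h (hne i)
        · exact absurd h.symm (hne j)
        · rw [h1, h2]
        · rw [h1.1, h2.1]
        · exact absurd ⟨h.symm, h1.2⟩ h2.2.2
        · exact absurd ⟨h, h2.2⟩ h1.2.2
        · rw [Fin.ext (by omega : (i : ℕ) = j), h]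
        · rw [h1.1, h2.1, h]
  · rintro ⟨g, hg⟩
    -- Copy `0` serves as the reference, so the empty graph is treated apart.
    rcases Nat.eq_zero_or_pos n with rfl | h0
    · exact ⟨Fin.elim0, fun u => u.elim0, fun u => u.elim0⟩
    obtain ⟨hb, hom⟩ := hg.attachCopies_copy hT ⟨0, h0⟩
    have hc : ∀ i, g (i, some none) = g (⟨0, h0⟩, some (some v)) := fun i =>
      (hg.attachCopies_link_eq hT h0 i i.2).trans (hg.attachCopies_link hT _)
    -- `τ` is the inverse of the automorphism given by copy `0`; it sends the common colour of the
    -- `q i` back to `v`.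
    choose τ hτ using hb.2
    change ∀ b, g (⟨0, h0⟩, some (some (τ b))) = b at hτ
    have hadj : ∀ {a b}, T.Adj a b → T.Adj (τ a) (τ b) := by
      intro a b h
      apply hT.adj_of_adj_map hb.1 hom
      rwa [hτ, hτ]
    have hτv : τ (g (⟨0, h0⟩, some (some v))) = v := hb.1 (hτ _)
    have hτi : ∀ {a b}, τ a = τ b → a = b := by
      intro a b h
      rw [← hτ a, ← hτ b, h]
    refine ⟨fun i => ⟨τ (g (i, none)), ?_, ?_⟩, ?_, ?_⟩
    · have h : T.Adj (g (i, some none)) (g (i, none)) := hg.1 (i, _) (i, _) rfl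
      rw [hc] at h
      have h' := hadj h
      rwa [hτv] at h'
    -- Otherwise `i` and the copy of `v`, two out-neighbours of `q i`, would have the same colour.
    · intro h
      have h1 : g (i, none) = g (i, some (some v)) := by
        rw [← hg.attachCopies_link hT, hc]
        exact hτi (h.trans hτv.symm)
      have := hg.eq_of_adj (i, some none) (i, none) (i, some (some v))
        rfl ⟨rfl, rfl⟩ h1
      simp at this
    · intro i j h
      exact hadj (hg.1 (i, none) (j, none) h)
    · refine fun i => ⟨?_, ?_⟩
      · intro a ha b hb hab
        have := hg.eq_of_adj (i, none) (a, none) (b, none) ha hb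
          (hτi (Subtype.ext_iff.1 hab))
        simpa using this
      · intro a ha b hb hab
        have := hg.eq_of_adj' (i, none) (a, none) (b, none) ha hb
          (hτi (Subtype.ext_iff.1 hab))
        simpa using this

end attachCopies

end Digraph

/-! ### A machine expanding every entry of a matrix into a square block -/

namespace BlockExpansion

open Turing Turing.TM2.Stmt

/-- The position of the column `j` relative to the diagonal of the row `i`. -/
def offsetMark (i j : ℕ) : Fin 4 :=
  if j = i then 1 else if j = i + 1 then 2 else if j + 1 = i then 3 else 0

theorem offsetMark_succ_succ (i j : ℕ) : offsetMark (i + 1) (j + 1) = offsetMark i j := by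
  simp [offsetMark]

/-- With `offsetMark_succ_succ`, this lets the machine pass to the next row without counting: shift
the marks by one column and prepend a mark determined by the old first one. -/
theorem offsetMark_succ_zero (i : ℕ) :
    offsetMark (i + 1) 0 = if offsetMark i 0 = 1 then 3 else 0 := by
  rcases i with _ | i
  · simp [offsetMark]
  · rcases i with _ | i <;> simp [offsetMark]

/-- The stacks of the machine. -/
inductive Stack
  | input | buffer | marks | reversed | output
  deriving DecidableEq

instance : Fintype Stack :=
  ⟨{.input, .buffer, .marks, .reversed, .output}, fun s => by cases s <;> decide⟩

/-- The stack alphabets. -/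
abbrev Symbol : Stack → Type
  | .input => Option Bool
  | .buffer => Bool × Fin 4
  | .marks => Fin 4
  | .reversed => Option Bool
  | .output => Option Bool

/-- The labels of the machine that replaces each entry by a `k × k` block. -/
inductive Label (k : ℕ)
  | init
  | row (a : Fin k)
  | back (a : Fin k)
  | clear
  | cleanup
  | flip
  deriving Fintype

/-- The internal states: the symbols read last. -/
abbrev State : Type := Option (Option Bool) × Option (Bool × Fin 4) × Fin 4

variable {k : ℕ}

/-- Forget the symbols read and continue at the label `l`. -/
def resume (l : Label k) : TM2.Stmt Symbol (Label k) State :=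
  load (fun _ => (none, none, 0)) (goto fun _ => l)

/-- Push several symbols, the first one first. -/
def pushAll {K Λ σ : Type*} {Γ : K → Type*} (s : K) (l : List (σ → Γ s))
    (q : TM2.Stmt Γ Λ σ) : TM2.Stmt Γ Λ σ :=
  l.foldr (fun f q => push s f q) q

theorem stepAux_pushAll {K Λ σ : Type*} {Γ : K → Type*} [DecidableEq K] (s : K)
    (l : List (σ → Γ s)) (q : TM2.Stmt Γ Λ σ) (v : σ) (S : ∀ s, List (Γ s)) :
    TM2.stepAux (pushAll s l q) v S =
      TM2.stepAux q v (Function.update S s ((l.map fun f => f v).reverse ++ S s)) := by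
  induction l generalizing S with
  | nil => simp [pushAll]
  | cons f l ih =>
    have := ih (Function.update S s (f v :: S s))
    simp only [pushAll, List.foldr_cons, TM2.stepAux] at this ⊢
    rw [this]
    simp

/-- The program. In each row of the input the entry `β` in column `j` is replaced, for `a` from
`0` to `k - 1`, by the bits `E a b β m` for `b < k`, where `m` is the mark of the column `j`; the
marks are shifted by one column when a row is finished. -/
def program [NeZero k] (E : Fin k → Fin k → Bool → Fin 4 → Bool) :
    Label k → TM2.Stmt Symbol (Label k) State
  -- The marks of row `0` are `1, 2, 0, 0, …`; absent marks are read as `0`.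
  | .init => push .marks (fun _ => 2) <| push .marks (fun _ => 1) <| resume (.row 0)
  | .row a =>
    pop .input (fun _ x => (x, none, 0)) <|
    branch (fun s => s.1.isNone) (resume .cleanup) <|
    branch (fun s => s.1 == some none)
      (push .reversed (fun _ => none) <|
        -- After the last pass the input row is discarded; otherwise its end symbol is put back and
        -- the row is rebuilt from the buffer.
        if (a : ℕ) + 1 = k then resume .clear
        else push .input (fun _ => none) <| resume (.back a)) <|
    pop .marks (fun s m => (s.1, none, m.getD 0)) <|
    pushAll .reversed
      (List.ofFn fun b s => some (E a b ((s.1.getD none).getD false) s.2.2)) <|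
    push .buffer (fun s => ((s.1.getD none).getD false, s.2.2)) <|
    resume (.row a)
  | .back a =>
    pop .buffer (fun _ y => (none, y, 0)) <|
    branch (fun s => s.2.1.isNone) (resume (.row (a + 1))) <|
    push .marks (fun s => (s.2.1.getD (false, 0)).2) <|
    push .input (fun s => some (s.2.1.getD (false, 0)).1) <|
    resume (.back a)
  | .clear =>
    pop .buffer (fun _ y => (none, y, 0)) <|
    branch (fun s => s.2.1.isNone)
      (peek .marks (fun _ m => (none, none, m.getD 0)) <|
        push .marks (fun s => if s.2.2 = 1 then 3 else 0) <| resume (.row 0)) <|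
    push .marks (fun s => (s.2.1.getD (false, 0)).2) <|
    resume .clear
  -- The first state component serves as a flag here: `some none` if a mark was popped, `none` if
  -- the stack was empty.
  | .cleanup =>
    pop .marks (fun _ m => (m.map fun _ => none, none, 0)) <|
    branch (fun s => s.1.isNone) (resume .flip) (resume .cleanup)
  | .flip =>
    pop .reversed (fun _ x => (x, none, 0)) <|
    branch (fun s => s.1.isNone) (load (fun _ => (none, none, 0)) halt) <|
    push .output (fun s => s.1.getD none) <|
    resume .flip

/-! ### Configurations and bounded reachability. -/

/-- The stacks with the given contents. -/
def contents (I : List (Option Bool)) (Y : List (Bool × Fin 4)) (P : List (Fin 4))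
    (R O : List (Option Bool)) : ∀ s, List (Symbol s)
  | .input => I
  | .buffer => Y
  | .marks => P
  | .reversed => R
  | .output => O

/-- The configuration with the given label and stacks, and no symbol remembered. -/
def cfg (l : Option (Label k)) (I : List (Option Bool)) (Y : List (Bool × Fin 4))
    (P : List (Fin 4)) (R O : List (Option Bool)) : TM2.Cfg Symbol (Label k) State :=
  ⟨l, (none, none, 0), contents I Y P R O⟩

section contents

variable (I I' : List (Option Bool)) (Y Y' : List (Bool × Fin 4)) (P P' : List (Fin 4))
  (R R' O O' : List (Option Bool))

@[simp] theorem stacks_input : contents I Y P R O .input = I := rfl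
@[simp] theorem stacks_buffer : contents I Y P R O .buffer = Y := rfl
@[simp] theorem stacks_marks : contents I Y P R O .marks = P := rfl
@[simp] theorem stacks_reversed : contents I Y P R O .reversed = R := rfl
@[simp] theorem stacks_output : contents I Y P R O .output = O := rfl

@[simp] theorem update_input :
    Function.update (contents I Y P R O) .input I' = contents I' Y P R O := by
  funext s; cases s <;> rfl

@[simp] theorem update_buffer :
    Function.update (contents I Y P R O) .buffer Y' = contents I Y' P R O := by
  funext s; cases s <;> rfl

@[simp] theorem update_marks :
    Function.update (contents I Y P R O) .marks P' = contents I Y P' R O := by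
  funext s; cases s <;> rfl

@[simp] theorem update_reversed :
    Function.update (contents I Y P R O) .reversed R' = contents I Y P R' O := by
  funext s; cases s <;> rfl

@[simp] theorem update_output :
    Function.update (contents I Y P R O) .output O' = contents I Y P R O' := by
  funext s; cases s <;> rfl

end contents

/-- `c'` is reached from `c` after at most `n` steps. -/
def ReachesIn {α : Type*} (f : α → Option α) (n : ℕ) (c c' : α) : Prop :=
  ∃ m ≤ n, (flip bind f)^[m] (some c) = some c'

namespace ReachesIn

variable {α : Type*} {f : α → Option α} {m n : ℕ} {c c' c'' : α}

theorem refl (c : α) : ReachesIn f 0 c c := ⟨0, le_rfl, rfl⟩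

theorem head (h : f c = some c') (h' : ReachesIn f n c' c'') : ReachesIn f (n + 1) c c'' := by
  obtain ⟨m, hm, e⟩ := h'
  refine ⟨m + 1, by omega, ?_⟩
  rw [Function.iterate_succ_apply]
  change (flip bind f)^[m] (f c) = _
  rw [h, e]

theorem single (h : f c = some c') : ReachesIn f 1 c c' := head h (refl c')

theorem trans (h : ReachesIn f m c c') (h' : ReachesIn f n c' c'') :
    ReachesIn f (m + n) c c'' := by
  obtain ⟨a, ha, e⟩ := h
  obtain ⟨b, hb, e'⟩ := h'
  refine ⟨b + a, by omega, ?_⟩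
  rw [Function.iterate_add_apply, e, e']

theorem mono (h : ReachesIn f m c c') (hmn : m ≤ n) : ReachesIn f n c c' := by
  obtain ⟨a, ha, e⟩ := h
  exact ⟨a, ha.trans hmn, e⟩

end ReachesIn

/-- The entries of a row, each with the mark of its column. -/
def annotate (μ : ℕ → Fin 4) (r : List Bool) : List (Bool × Fin 4) :=
  r.mapIdx fun j β => (β, μ j)

theorem annotate_cons (μ : ℕ → Fin 4) (β : Bool) (r : List Bool) :
    annotate μ (β :: r) = (β, μ 0) :: annotate (fun j => μ (j + 1)) r :=
  List.mapIdx_cons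

/-- The row of index `a` of the blocks of an annotated row. -/
def expandRow (E : Fin k → Fin k → Bool → Fin 4 → Bool) (a : Fin k) (z : List (Bool × Fin 4)) :
    List (Option Bool) :=
  z.flatMap fun p => List.ofFn fun b => some (E a b p.1 p.2)

/-- The rows of the blocks of an annotated row whose indices are in `l`. -/
def expandRows (E : Fin k → Fin k → Bool → Fin 4 → Bool) (l : List (Fin k))
    (z : List (Bool × Fin 4)) : List (Option Bool) :=
  l.flatMap fun a => expandRow E a z ++ [none]

/-- The expansion of a matrix whose first row has index `i`. -/
def expandMatrix (E : Fin k → Fin k → Bool → Fin 4 → Bool) :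
    ℕ → List (List Bool) → List (Option Bool)
  | _, [] => []
  | i, r :: rs =>
    expandRows E (List.finRange k) (annotate (offsetMark i) r) ++ expandMatrix E (i + 1) rs

/-! ### Single steps and the inner loops. -/

section run

variable [NeZero k] (E : Fin k → Fin k → Bool → Fin 4 → Bool)
  (I : List (Option Bool)) (Y : List (Bool × Fin 4)) (P : List (Fin 4)) (R O : List (Option Bool))

theorem step_row_some (a : Fin k) (β : Bool) :
    TM2.step (program E) (cfg (some (.row a)) (some β :: I) Y P R O) =
      some (cfg (some (.row a)) I ((β, P.getD 0 0) :: Y) P.tail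
        ((List.ofFn fun b => some (E a b β (P.getD 0 0))).reverse ++ R) O) := by
  cases P <;> simp [cfg, program, resume, stepAux_pushAll, List.map_ofFn, Function.comp_def]

theorem step_row_none (a : Fin k) (ha : (a : ℕ) + 1 ≠ k) :
    TM2.step (program E) (cfg (some (.row a)) (none :: I) Y P R O) =
      some (cfg (some (.back a)) (none :: I) Y P (none :: R) O) := by
  simp [cfg, program, resume, ha]

theorem step_row_last (a : Fin k) (ha : (a : ℕ) + 1 = k) :
    TM2.step (program E) (cfg (some (.row a)) (none :: I) Y P R O) =
      some (cfg (some .clear) I Y P (none :: R) O) := by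
  simp [cfg, program, resume, ha]

theorem step_row_nil (a : Fin k) :
    TM2.step (program E) (cfg (some (.row a)) [] Y P R O) =
      some (cfg (some .cleanup) [] Y P R O) := by
  simp [cfg, program, resume]

theorem step_back_cons (a : Fin k) (y : Bool × Fin 4) :
    TM2.step (program E) (cfg (some (.back a)) I (y :: Y) P R O) =
      some (cfg (some (.back a)) (some y.1 :: I) Y (y.2 :: P) R O) := by
  simp [cfg, program, resume]

theorem step_back_nil (a : Fin k) :
    TM2.step (program E) (cfg (some (.back a)) I [] P R O) =
      some (cfg (some (.row (a + 1))) I [] P R O) := by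
  simp [cfg, program, resume]

theorem step_clear_cons (y : Bool × Fin 4) :
    TM2.step (program E) (cfg (some .clear) I (y :: Y) P R O) =
      some (cfg (some .clear) I Y (y.2 :: P) R O) := by
  simp [cfg, program, resume]

theorem step_clear_nil :
    TM2.step (program E) (cfg (some .clear) I [] P R O) =
      some (cfg (some (.row 0)) I [] ((if P.getD 0 0 = 1 then 3 else 0) :: P) R O) := by
  cases P <;> simp [cfg, program, resume]

theorem step_init :
    TM2.step (program E) (cfg (some .init) I Y P R O) =
      some (cfg (some (.row 0)) I Y (1 :: 2 :: P) R O) := by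
  simp [cfg, program, resume]

theorem reachesIn_row (a : Fin k) (r : List Bool) :
    ReachesIn (TM2.step (program E)) r.length
      (cfg (some (.row a)) (r.map some ++ I) Y P R O)
      (cfg (some (.row a)) I ((annotate (P.getD · 0) r).reverse ++ Y) (P.drop r.length)
        ((expandRow E a (annotate (P.getD · 0) r)).reverse ++ R) O) := by
  induction r generalizing Y P R with
  | nil => simpa [annotate, expandRow] using ReachesIn.refl _
  | cons β r ih =>
    refine ReachesIn.head (step_row_some E _ _ _ _ _ _ _) ?_
    simpa [annotate_cons, expandRow] using
      ih ((β, P.getD 0 0) :: Y) P.tail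
        ((List.ofFn fun b => some (E a b β (P.getD 0 0))).reverse ++ R)

theorem reachesIn_back (a : Fin k) :
    ReachesIn (TM2.step (program E)) (Y.length + 1)
      (cfg (some (.back a)) I Y P R O)
      (cfg (some (.row (a + 1))) ((Y.map fun y => some y.1).reverse ++ I) []
        ((Y.map Prod.snd).reverse ++ P) R O) := by
  induction Y generalizing I P with
  | nil => exact ReachesIn.single (step_back_nil E _ _ _ _ _)
  | cons y Y ih =>
    refine ReachesIn.head (step_back_cons E _ _ _ _ _ _ _) ?_
    simpa using ih (some y.1 :: I) (y.2 :: P)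

theorem reachesIn_clear :
    ReachesIn (TM2.step (program E)) (Y.length + 1)
      (cfg (some .clear) I Y P R O)
      (cfg (some (.row 0)) I []
        ((if ((Y.map Prod.snd).reverse ++ P).getD 0 0 = 1 then 3 else 0) ::
          ((Y.map Prod.snd).reverse ++ P)) R O) := by
  induction Y generalizing P with
  | nil => exact ReachesIn.single (step_clear_nil E _ _ _ _)
  | cons y Y ih =>
    refine ReachesIn.head (step_clear_cons E _ _ _ _ _ _) ?_
    simpa using ih (y.2 :: P)

theorem reachesIn_cleanup :
    ReachesIn (TM2.step (program E)) (P.length + 1)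
      (cfg (some .cleanup) I Y P R O) (cfg (some .flip) I Y [] R O) := by
  induction P with
  | nil => exact ReachesIn.single (by simp [cfg, program, resume])
  | cons m P ih => exact ReachesIn.head (by simp [cfg, program, resume]) ih

theorem reachesIn_flip :
    ReachesIn (TM2.step (program E)) (R.length + 1)
      (cfg (some .flip) I Y P R O) (cfg none I Y P [] (R.reverse ++ O)) := by
  induction R generalizing O with
  | nil => exact ReachesIn.single (by simp [cfg, program])
  | cons x R ih =>
    refine ReachesIn.head (c' := cfg (some .flip) I Y P R (x :: O))
      (by simp [cfg, program, resume]) ?_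
    simpa using ih (x :: O)

end run

theorem length_annotate (μ : ℕ → Fin 4) (r : List Bool) : (annotate μ r).length = r.length := by
  simp [annotate]

theorem annotate_map_fst (μ : ℕ → Fin 4) (r : List Bool) :
    (annotate μ r).map (fun y => some y.1) = r.map some := by
  apply List.ext_getElem <;> simp [annotate]

/-- The marks after a pass over a row: the list is extended to the length of the row. -/
def extendMarks (P : List (Fin 4)) (r : List Bool) : List (Fin 4) :=
  (annotate (P.getD · 0) r).map Prod.snd ++ P.drop r.length

/-- A pass may lengthen the list of marks, but only with explicit zeros, so the marks as a function
of the column are unchanged. -/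
theorem extendMarks_getD (P : List (Fin 4)) (r : List Bool) (j : ℕ) :
    (extendMarks P r).getD j 0 = P.getD j 0 := by
  by_cases hj : j < r.length
  · simp [extendMarks, annotate, List.getElem?_append, hj]
  · have : r.length + (j - r.length) = j := by omega
    simp [extendMarks, annotate, List.getElem?_append, hj, this]

theorem length_extendMarks (P : List (Fin 4)) (r : List Bool) :
    (extendMarks P r).length = max P.length r.length := by
  simp [extendMarks, length_annotate]
  omega

/-! ### Passes over a row, rows, and the complete run. -/

section run

variable [NeZero k] (E : Fin k → Fin k → Bool → Fin 4 → Bool)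
  (I : List (Option Bool)) (P : List (Fin 4)) (R O : List (Option Bool))

theorem reachesIn_pass (a : Fin k) (ha : (a : ℕ) + 1 ≠ k) (r : List Bool) :
    ReachesIn (TM2.step (program E)) (2 * r.length + 2)
      (cfg (some (.row a)) (r.map some ++ none :: I) [] P R O)
      (cfg (some (.row (a + 1))) (r.map some ++ none :: I) [] (extendMarks P r)
        ((expandRow E a (annotate (P.getD · 0) r) ++ [none]).reverse ++ R) O) := by
  have h := ((reachesIn_row E (none :: I) [] P R O a r).trans
    (ReachesIn.single (step_row_none E _ _ _ _ _ a ha))).trans (reachesIn_back E _ _ _ _ _ a)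
  simp only [List.append_nil, List.length_reverse, length_annotate, List.map_reverse,
    List.reverse_reverse, annotate_map_fst] at h
  simpa [extendMarks] using h.mono (by omega : _ ≤ 2 * r.length + 2)

theorem reachesIn_last_pass (a : Fin k) (ha : (a : ℕ) + 1 = k) (r : List Bool) :
    ReachesIn (TM2.step (program E)) (2 * r.length + 2)
      (cfg (some (.row a)) (r.map some ++ none :: I) [] P R O)
      (cfg (some (.row 0)) I []
        ((if P.getD 0 0 = 1 then 3 else 0) :: extendMarks P r)
        ((expandRow E a (annotate (P.getD · 0) r) ++ [none]).reverse ++ R) O) := by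
  have h := ((reachesIn_row E (none :: I) [] P R O a r).trans
    (ReachesIn.single (step_row_last E _ _ _ _ _ a ha))).trans (reachesIn_clear E _ _ _ _ _)
  simp only [List.append_nil, List.length_reverse, length_annotate, List.map_reverse,
    List.reverse_reverse] at h
  change ReachesIn _ _ _ (cfg _ _ _ ((if (extendMarks P r).getD 0 0 = 1 then 3 else 0) ::
    extendMarks P r) _ _) at h
  rw [extendMarks_getD] at h
  simpa using h.mono (by omega : _ ≤ 2 * r.length + 2)

/-- Induction on the number `d` of passes left after the current one. The final list of marks
matters only through its values and a length bound, so it is left existential. -/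
theorem reachesIn_passes (r : List Bool) (d : ℕ) (a : Fin k) (ha : (a : ℕ) + d + 1 = k) :
    ∃ P', (∀ j, P'.getD j 0 = P.getD j 0) ∧ P'.length ≤ max P.length r.length ∧
      ReachesIn (TM2.step (program E)) ((d + 1) * (2 * r.length + 2))
        (cfg (some (.row a)) (r.map some ++ none :: I) [] P R O)
        (cfg (some (.row 0)) I [] ((if P.getD 0 0 = 1 then 3 else 0) :: P')
          ((expandRows E ((List.finRange k).drop a) (annotate (P.getD · 0) r)).reverse ++ R)
          O) := by
  have hdrop : (List.finRange k).drop a = a :: (List.finRange k).drop (a + 1) := by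
    rw [List.drop_eq_getElem_cons (by simp)]
    simp
  induction d generalizing a P R with
  | zero =>
    refine ⟨extendMarks P r, extendMarks_getD P r, (length_extendMarks P r).le, ?_⟩
    have h := reachesIn_last_pass E I P R O a (by omega) r
    rw [hdrop, List.drop_eq_nil_of_le (by simp; omega)]
    simpa [expandRows] using h
  | succ d ih =>
    have ha1 : ((a + 1 : Fin k) : ℕ) = a + 1 := by
      rw [Fin.val_add_one_of_lt']
      omega
    obtain ⟨P', h1, h2, h3⟩ := ih (extendMarks P r)
      ((expandRow E a (annotate (P.getD · 0) r) ++ [none]).reverse ++ R) (a + 1) (by omega)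
      (by
        rw [List.drop_eq_getElem_cons (by simp)]
        simp)
    refine ⟨P', fun j => (h1 j).trans (extendMarks_getD P r j), ?_, ?_⟩
    · rw [length_extendMarks] at h2
      omega
    · have h := (reachesIn_pass E I P R O a (by omega) r).trans h3
      simp only [extendMarks_getD] at h
      rw [hdrop]
      rw [ha1] at h
      convert h using 1
      · ring
      · simp [expandRows]

/-- The invariant `hP` says that the marks describe row `i`. Each row prepends one mark, whence the
summand `rows.length` in the bound needed for the cleanup. -/
theorem reachesIn_rows (n : ℕ) (rows : List (List Bool)) (hn : ∀ r ∈ rows, r.length = n) (i : ℕ)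
    (hP : ∀ j, P.getD j 0 = offsetMark i j) :
    ∃ P', P'.length ≤ max P.length n + rows.length ∧
      ReachesIn (TM2.step (program E)) (rows.length * (k * (2 * n + 2)))
        (cfg (some (.row 0)) (rows.flatMap fun r => r.map some ++ [none]) [] P R O)
        (cfg (some (.row 0)) [] [] P' ((expandMatrix E i rows).reverse ++ R) O) := by
  induction rows generalizing i P R with
  | nil => exact ⟨P, by simp, by simpa [expandMatrix] using ReachesIn.refl _⟩
  | cons r rows ih =>
    have hk := NeZero.pos k
    have hr : r.length = n := hn r (by simp)
    obtain ⟨P₁, h1, h2, h3⟩ := reachesIn_passes E (rows.flatMap fun r => r.map some ++ [none]) P R O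
      r (k - 1) 0 (by simp; omega)
    have hP₁ : ∀ j, ((if P.getD 0 0 = 1 then 3 else 0) :: P₁).getD j 0 = offsetMark (i + 1) j := by
      rintro (_ | j)
      · rw [hP, offsetMark_succ_zero]
        rfl
      · rw [offsetMark_succ_succ, ← hP]
        exact h1 j
    obtain ⟨P', h4, h5⟩ := ih ((if P.getD 0 0 = 1 then 3 else 0) :: P₁)
      ((expandRows E (List.finRange k) (annotate (P.getD · 0) r)).reverse ++ R)
      (fun r hr => hn r (by simp [hr])) (i + 1) hP₁
    refine ⟨P', ?_, ?_⟩
    · simp only [List.length_cons] at h4 ⊢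
      omega
    · have h := ReachesIn.trans (by simpa using h3) h5
      rw [Nat.sub_add_cancel hk, hr] at h
      have hμ : (P.getD · 0) = offsetMark i := funext hP
      rw [hμ] at h
      convert h using 1
      · simp only [List.length_cons]
        ring
      · simp
      · simp [expandMatrix]

theorem reachesIn_halt (n : ℕ) (rows : List (List Bool)) (hn : ∀ r ∈ rows, r.length = n) :
    ReachesIn (TM2.step (program E))
      (rows.length * (k * (2 * n + 2)) + n + rows.length + (expandMatrix E 0 rows).length + 6)
      (cfg (some .init) (rows.flatMap fun r => r.map some ++ [none]) [] [] [] [])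
      (cfg none [] [] [] [] (expandMatrix E 0 rows)) := by
  obtain ⟨P, hP, h⟩ := reachesIn_rows E [1, 2] [] [] n rows hn 0 (by
    rintro (_ | _ | j) <;> simp [offsetMark])
  have h' := ((ReachesIn.head (step_init E _ _ _ _ _) h).trans
    (ReachesIn.single (step_row_nil E _ _ _ _ _))).trans
    ((reachesIn_cleanup E _ _ _ _ _).trans (reachesIn_flip E _ _ _ _ _))
  -- The `2` accounts for the two initial marks; the other `4` steps of the constant `6` are the
  -- initial step, the detection of the end of the input, and the last steps of `cleanup` and
  -- `flip`.
  have hP' : P.length ≤ n + 2 + rows.length := by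
    simp only [List.length_cons, List.length_nil] at hP
    omega
  simp only [List.append_nil, List.length_reverse, List.reverse_reverse] at h'
  exact h'.mono (by omega)

end run


/-! ### Correctness of the output and the polynomial time bound. -/

/-- The machine running `program E`. -/
def machine [NeZero k] (E : Fin k → Fin k → Bool → Fin 4 → Bool) : FinTM2 where
  K := Stack
  k₀ := .input
  k₁ := .output
  Γ := Symbol
  Λ := Label k
  main := .init
  σ := State
  initialState := (none, none, 0)
  Γk₀Fin := inferInstanceAs (Fintype (Option Bool))
  m := program E

theorem initList_machine [NeZero k] (E : Fin k → Fin k → Bool → Fin 4 → Bool)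
    (I : List (Option Bool)) :
    initList (machine E) I = cfg (some .init) I [] [] [] [] := by
  simp only [initList, cfg]
  congr 1
  funext s
  cases s <;> rfl

theorem haltList_machine [NeZero k] (E : Fin k → Fin k → Bool → Fin 4 → Bool)
    (O : List (Option Bool)) :
    haltList (machine E) O = cfg none [] [] [] [] O := by
  simp only [haltList, cfg]
  congr 1
  funext s
  cases s <;> rfl

theorem annotate_ofFn (μ : ℕ → Fin 4) {n : ℕ} (f : Fin n → Bool) :
    annotate μ (List.ofFn f) = List.ofFn fun j => (f j, μ j) := by
  apply List.ext_getElem <;> simp [annotate]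

theorem flatMap_ofFn {α β : Type*} {n : ℕ} (f : Fin n → α) (g : α → List β) :
    (List.ofFn f).flatMap g = (List.ofFn fun i => g (f i)).flatten := by
  rw [List.flatMap_def, List.map_ofFn]
  rfl

theorem expandMatrix_ofFn (E : Fin k → Fin k → Bool → Fin 4 → Bool) {n : ℕ} (i : ℕ)
    (f : Fin n → List Bool) :
    expandMatrix E i (List.ofFn f) =
      (List.ofFn fun u : Fin n =>
        expandRows E (List.finRange k) (annotate (offsetMark (i + u)) (f u))).flatten := by
  induction n generalizing i with
  | zero => simp [expandMatrix]
  | succ n ih =>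
    simp only [List.ofFn_succ, expandMatrix, ih, List.flatten_cons]
    simp [Nat.add_comm, Nat.add_left_comm]

/-- The instance whose adjacency matrix is obtained by replacing each entry by a block. -/
def expand (E : Fin k → Fin k → Bool → Fin 4 → Bool) (I : OrientedGraphInstance)
    (h : (Digraph.mk' fun u w : Fin (I.order * k) => E u.modNat w.modNat
      (I.matrix u.divNat w.divNat) (offsetMark u.divNat w.divNat)).IsOriented) :
    OrientedGraphInstance where
  order := I.order * k
  matrix u w := E u.modNat w.modNat (I.matrix u.divNat w.divNat) (offsetMark u.divNat w.divNat)
  oriented := h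

theorem encode_eq (I : OrientedGraphInstance) :
    I.encode = (List.ofFn fun u => List.ofFn (I.matrix u)).flatMap
      fun r => r.map some ++ [none] := by
  rw [flatMap_ofFn, OrientedGraphInstance.encode]
  congr 2
  funext u
  simp [OrientedGraphInstance.encodeRow, List.map_ofFn, Function.comp_def]

theorem length_encode (I : OrientedGraphInstance) :
    I.encode.length = I.order * (I.order + 1) := by
  simp [OrientedGraphInstance.encode, OrientedGraphInstance.encodeRow, List.length_flatten,
    List.map_ofFn, Function.comp_def]

theorem divNat_mk {m n : ℕ} (i : Fin m) (a : Fin n) (h : (i : ℕ) * n + a < m * n) :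
    (⟨i * n + a, h⟩ : Fin (m * n)).divNat = i := by
  apply Fin.ext
  have hn : 0 < n := a.pos
  simp only [Fin.coe_divNat]
  rw [Nat.mul_comm, Nat.mul_add_div hn, Nat.div_eq_of_lt a.2, Nat.add_zero]

theorem modNat_mk {m n : ℕ} (i : Fin m) (a : Fin n) (h : (i : ℕ) * n + a < m * n) :
    (⟨i * n + a, h⟩ : Fin (m * n)).modNat = a := by
  apply Fin.ext
  simp only [Fin.coe_modNat]
  rw [Nat.mul_comm, Nat.mul_add_mod, Nat.mod_eq_of_lt a.2]

/-- Row `i * k + a` of the new matrix is made of the `a`-th rows of the blocks in row `i`, which is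
what pass `a` over row `i` writes. -/
theorem encode_expand (E : Fin k → Fin k → Bool → Fin 4 → Bool) (I : OrientedGraphInstance)
    (h : (Digraph.mk' fun u w : Fin (I.order * k) => E u.modNat w.modNat
      (I.matrix u.divNat w.divNat) (offsetMark u.divNat w.divNat)).IsOriented) :
    (expand E I h).encode =
      expandMatrix E 0 (List.ofFn fun u => List.ofFn (I.matrix u)) := by
  rw [expandMatrix_ofFn, OrientedGraphInstance.encode]
  change (List.ofFn fun u : Fin (I.order * k) => _).flatten = _
  rw [List.ofFn_mul, List.flatten_flatten, List.map_ofFn]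
  congr 2
  funext i
  rw [Function.comp_apply, expandRows, List.flatMap_def, List.ofFn_eq_map]
  congr 2
  funext a
  change (List.ofFn fun w : Fin (I.order * k) => _) ++ [none] = _
  congr 1
  rw [annotate_ofFn, expandRow, flatMap_ofFn, List.ofFn_mul]
  simp only [expand, divNat_mk, modNat_mk, Nat.zero_add]

theorem length_expandMatrix (E : Fin k → Fin k → Bool → Fin 4 → Bool)
    (I : OrientedGraphInstance)
    (h : (Digraph.mk' fun u w : Fin (I.order * k) => E u.modNat w.modNat
      (I.matrix u.divNat w.divNat) (offsetMark u.divNat w.divNat)).IsOriented) :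
    (expandMatrix E 0 (List.ofFn fun u => List.ofFn (I.matrix u))).length =
      I.order * k * (I.order * k + 1) := by
  rw [← encode_expand E I h, length_encode]
  rfl

/-- Replacing entries by blocks is computable in polynomial time. -/
theorem nonempty_computable_expand [NeZero k] (E : Fin k → Fin k → Bool → Fin 4 → Bool)
    (h : ∀ I : OrientedGraphInstance, (Digraph.mk' fun u w : Fin (I.order * k) =>
      E u.modNat w.modNat (I.matrix u.divNat w.divNat)
        (offsetMark u.divNat w.divNat)).IsOriented) :
    Nonempty (TM2ComputableInPolyTime OrientedGraphInstance.encode OrientedGraphInstance.encode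
      fun I => expand E I (h I)) := by
  have run : ∀ I : OrientedGraphInstance, ReachesIn (machine E).step
      -- With input length `n * (n + 1)`, the passes cost `2 * k` times this; the output length is
      -- at most `k ^ 2` times it, and the `2 * n` steps for marks at most twice it.
      ((Polynomial.C (2 * k + k ^ 2 + 2) * Polynomial.X + Polynomial.C 6).eval I.encode.length)
      (initList (machine E) I.encode) (haltList (machine E) (expand E I (h I)).encode) := by
    intro I
    have hrun := reachesIn_halt E I.order (List.ofFn fun u => List.ofFn (I.matrix u))
      (by simp [List.mem_ofFn])
    rw [initList_machine, haltList_machine, encode_expand, encode_eq]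
    refine hrun.mono ?_
    rw [← encode_eq, length_expandMatrix E I (h I), length_encode, List.length_ofFn]
    simp only [Polynomial.eval_add, Polynomial.eval_mul, Polynomial.eval_C,
      Polynomial.eval_X]
    have hk : 1 ≤ k := NeZero.pos k
    have h1 : I.order * k ≤ I.order * k ^ 2 := by
      gcongr
      nlinarith
    nlinarith [h1, Nat.zero_le (I.order ^ 2)]
  refine ⟨⟨⟨machine E, Equiv.refl (Option Bool), Equiv.refl (Option Bool)⟩,
    Polynomial.C (2 * k + k ^ 2 + 2) * Polynomial.X + Polynomial.C 6, fun I => Classical.choice ?_⟩⟩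
  obtain ⟨m, hm, e⟩ := run I
  refine ⟨⟨⟨m, ?_⟩, hm⟩⟩
  have hid : ∀ l : List (Option Bool), l.map (Equiv.refl (Option Bool)).invFun = l :=
    fun l => List.map_id l
  -- The words are transported along identity equivalences of alphabets; arbitrary `l` and `l'`
  -- absorb this.
  have key : ∀ l l', l = I.encode → l' = (expand E I (h I)).encode →
      (flip bind (machine E).step)^[m] (some (initList (machine E) l)) =
        some (haltList (machine E) l') := by
    rintro _ _ rfl rfl
    exact e
  exact key _ _ (hid _) (hid _)

end BlockExpansion

/-! ### From block substitutions to polynomial transformations. -/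

/-- If the instances of ios-injective homomorphism to `T'` can be turned into instances of
ios-injective homomorphism to `T` by replacing each entry of the adjacency matrix by a block that
depends only on the entry and on its position relative to the diagonal, then the first problem
polynomially transforms to the second. -/
theorem polynomiallyTransformsTo_of_blocks {V V' W : Type*} [Finite W] [Nonempty W]
    (T : Digraph V) (T' : Digraph V')
    (F : ∀ I : OrientedGraphInstance, Digraph (Fin I.order × W))
    (entry : W → W → Bool → Fin 4 → Prop)
    (hF : ∀ I i j a b, (F I).Adj (i, a) (j, b) ↔
      entry a b (I.matrix i j) (BlockExpansion.offsetMark i j))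
    (hor : ∀ I, (F I).IsOriented)
    (hyes : ∀ I : OrientedGraphInstance,
      (∃ f, I.graph.IsIosInjectiveHom T' f) ↔ ∃ g, (F I).IsIosInjectiveHom T g) :
    (iosInjectiveHomProblem T').PolynomiallyTransformsTo (iosInjectiveHomProblem T) := by
  classical
  obtain ⟨k, ⟨e⟩⟩ := Finite.exists_equiv_fin W
  have : NeZero k := ⟨by
    rintro rfl
    exact (e (Classical.arbitrary W)).elim0⟩
  let E : Fin k → Fin k → Bool → Fin 4 → Bool := fun a b β m =>
    decide (entry (e.symm a) (e.symm b) β m)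
  have hE : ∀ (I : OrientedGraphInstance) (u w : Fin (I.order * k)),
      (Digraph.mk' fun u w : Fin (I.order * k) => E u.modNat w.modNat
        (I.matrix u.divNat w.divNat) (BlockExpansion.offsetMark u.divNat w.divNat)).Adj u w ↔
      (F I).Adj (u.divNat, e.symm u.modNat) (w.divNat, e.symm w.modNat) := by
    intro I u w
    rw [hF]
    exact decide_eq_true_iff
  let d : ∀ I : OrientedGraphInstance, Fin (I.order * k) ≃ Fin I.order × W := fun I =>
    finProdFinEquiv.symm.trans (Equiv.prodCongr (Equiv.refl _) e.symm)
  have h : ∀ I : OrientedGraphInstance, (Digraph.mk' fun u w : Fin (I.order * k) =>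
      E u.modNat w.modNat (I.matrix u.divNat w.divNat)
        (BlockExpansion.offsetMark u.divNat w.divNat)).IsOriented := by
    intro I u w huw h1 h2
    rw [hE] at h1 h2
    exact hor I _ _ ((d I).injective.ne huw) h1 h2
  refine ⟨fun I => BlockExpansion.expand E I (h I),
    BlockExpansion.nonempty_computable_expand E h, fun I => (hyes I).trans ?_⟩
  exact (Digraph.exists_isIosInjectiveHom_congr T (d I) (hE I)).symm

namespace Digraph

/-- The entries of the adjacency matrix of `attachCopies G T v` between the blocks of two vertices
of `G`, in terms of the adjacency of these vertices and of their relative position. -/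
def attachEntry {V : Type*} (T : Digraph V) (v : V) :
    Option (Option V) → Option (Option V) → Prop → Fin 4 → Prop
  | none, none, β, _ => β
  | none, some _, _, _ => False
  | some none, none, _, m => m = 1
  | some none, some none, _, _ => False
  | some none, some (some w), _, m => m = 1 ∧ w = v
  | some (some _), none, _, _ => False
  | some (some u), some none, _, m => u = v ∧ m = 3
  | some (some u), some (some w), _, m => m = 1 ∧ T.Adj u w ∧ ¬ (u = v ∧ w = v)

theorem attachCopies_adj_iff {n : ℕ} {V : Type*} (G : Digraph (Fin n)) (T : Digraph V) (v : V)
    (i j : Fin n) (a b : Option (Option V)) :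
    (G.attachCopies T v).Adj (i, a) (j, b) ↔
      T.attachEntry v a b (G.Adj i j) (BlockExpansion.offsetMark i j) := by
  have h1 : BlockExpansion.offsetMark i j = 1 ↔ i = j := by
    rw [Fin.ext_iff, BlockExpansion.offsetMark]
    split_ifs <;> simp <;> omega
  have h3 : BlockExpansion.offsetMark i j = 3 ↔ (j : ℕ) + 1 = i := by
    rw [BlockExpansion.offsetMark]
    split_ifs <;> simp <;> omega
  rcases a with _ | _ | u <;> rcases b with _ | _ | w <;> simp [attachCopies, attachEntry, h1, h3]

end Digraph

theorem polynomiallyTransformsTo_strictOutNbhd {V : Type*} [Finite V] (T : Digraph V)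
    (hT : T.IsReflexiveTournament) (v : V) :
    (iosInjectiveHomProblem (T.inducedOn (T.strictOutNbhd v))).PolynomiallyTransformsTo
      (iosInjectiveHomProblem T) :=
  polynomiallyTransformsTo_of_blocks T _ (fun I => I.graph.attachCopies T v)
    (fun a b β => T.attachEntry v a b (β = true))
    (fun I => I.graph.attachCopies_adj_iff T v)
    (fun I => Digraph.attachCopies_isOriented I.oriented hT)
    (fun _ => Digraph.exists_attachCopies_iff hT)

/-- Reverse `G` and `T`, attach the copies, and reverse back. Reversal transposes the matrix, so the
blocks are transposed and the marks `2` and `3`, just above and just below the diagonal, are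
exchanged. -/
theorem polynomiallyTransformsTo_strictInNbhd {V : Type*} [Finite V] (T : Digraph V)
    (hT : T.IsReflexiveTournament) (v : V) :
    (iosInjectiveHomProblem (T.inducedOn (T.strictInNbhd v))).PolynomiallyTransformsTo
      (iosInjectiveHomProblem T) := by
  refine polynomiallyTransformsTo_of_blocks T _
    (fun I => (I.graph.reverse.attachCopies T.reverse v).reverse)
    (fun a b β m => T.reverse.attachEntry v b a (β = true)
      (if m = 2 then 3 else if m = 3 then 2 else m)) ?_
    (fun I => (Digraph.attachCopies_isOriented
      (Digraph.IsOriented.reverse I.oriented) hT.reverse).reverse) ?_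
  · intro I i j a b
    have h : BlockExpansion.offsetMark j i =
        if BlockExpansion.offsetMark i j = 2 then 3
        else if BlockExpansion.offsetMark i j = 3 then 2 else BlockExpansion.offsetMark i j := by
      simp only [BlockExpansion.offsetMark]
      split_ifs <;> first | rfl | omega
    rw [← h]
    exact I.graph.reverse.attachCopies_adj_iff T.reverse v j i b a
  · intro I
    have h := Digraph.exists_attachCopies_iff (G := I.graph.reverse) (v := v) hT.reverse
    constructor
    · rintro ⟨f, hf⟩
      obtain ⟨g, hg⟩ := h.1 ⟨f, Digraph.isIosInjectiveHom_reverse_iff.2 hf⟩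
      exact ⟨g, Digraph.isIosInjectiveHom_reverse_iff.2 hg⟩
    · rintro ⟨g, hg⟩
      obtain ⟨f, hf⟩ := h.2 ⟨g, Digraph.isIosInjectiveHom_reverse_iff.2 hg⟩
      exact ⟨f, Digraph.isIosInjectiveHom_reverse_iff.2 hf⟩

theorem mainTheorem7 {V : Type*} [Finite V] (T : Digraph V) (hT : T.IsReflexiveTournament)
    (v : V) :
    (4 ≤ (T.outNbhd v).ncard →
      (iosInjectiveHomProblem (T.inducedOn (T.strictOutNbhd v))).PolynomiallyTransformsTo
        (iosInjectiveHomProblem T)) ∧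
    (4 ≤ (T.inNbhd v).ncard →
      (iosInjectiveHomProblem (T.inducedOn (T.strictInNbhd v))).PolynomiallyTransformsTo
        (iosInjectiveHomProblem T)) :=
  ⟨fun _ => polynomiallyTransformsTo_strictOutNbhd T hT v,
    fun _ => polynomiallyTransformsTo_strictInNbhd T hT v⟩
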